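/- For positive integers $N$ let $U\mathfrak{gl}(N)$ be the universal enveloping algebra of the complex Lie algebra of $N\times N$ matrices, with matrix units $E_{ij}$. For $\alpha\in\mathbb S_m$ put $$w_{\mathfrak{gl}(N)}(\alpha)=\sum_{i_1,\dots,i_m=1}^N E_{i_1i_{\alpha(1)}}\cdots E_{i_mi_{\alpha(m)}}\in U\mathfrak{gl}(N),$$ and let $C_k=w_{\mathfrak{gl}(N)}((1\,2\,\dots\,k))$, $k\ge1$, be the Casimir elements, which are central. A universal $\mathfrak{gl}$-weight system is a function $w_{\mathfrak{gl}}$ on permutations with values in $\mathbb C[N][C_1,C_2,\dots]$ such that, for every $N=1,2,\dots$, substituting this number for the variable $N$ and the Casimir elements of $U\mathfrak{gl}(N)$ for the variables $C_k$ turns $w_{\mathfrak{gl}}(\alpha)$ into $w_{\mathfrak{gl}(N)}(\alpha)$ for all $\alpha$. Let $\mathrm{St}_N:U\mathfrak{gl}(N)\to \mathrm{Mat}_N(\mathbb C)$ be the standard representation (the algebra homomorphism that is the identity on $\mathfrak{gl}(N)$) and let $T(a)=\frac1N\mathrm{Tr}\,\mathrm{St}_N(a)$. For $\alpha\in\mathbb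 S_m$, $m\ge1$, the number of faces $f(\alpha)$ is the number of independent cycles (fixed points included) of $\alpha^{-1}\circ\sigma$, where $\sigma=(1\,2\,\dots\,m)$ is the standard cycle; for the empty permutation ($m=0$), $f=1$. Thus $f(\alpha)\ge1$ always. Theorem. 1. For all $N\ge1$ and $k\ge1$, $T(C_k)=N^{k-1}$. Moreover, for every polynomial $P\in\mathbb C[N][C_1,C_2,\dots]$ and every $N\ge1$, the value of $T$ on the specialization of $P$ in $U\mathfrak{gl}(N)$ is obtained from $P$ by the substitution $C_k\mapsto N^{k-1}$; so $T$ induces the $\mathbb C[N]$-algebra homomorphism $T:\mathbb C[N][C_1,C_2,\dots]\to\mathbb C[N]$, $C_k\mapsto N^{k-1}$. 2. For all $m\ge0$, $\alpha\in\mathbb S_m$ and $N\ge1$, $T(w_{\mathfrak{gl}(N)}(\alpha))=N^{f(\alpha)-1}$. 3. A universal $\mathfrak{gl}$-weight system exists, and for every such $w_{\mathfrak{gl}}$ the mapping $F=T\circ w_{\mathfrak{gl}}$ takes each permutation $\alpha\in\mathbb S_m$, $m\ge0$, to the monomial $N^{f(\alpha)-1}\in\mathbb C[N]$. -/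

import Mathlib

attribute [local instance] LieRing.ofAssociativeRing

noncomputable section

/-- The universal enveloping algebra `U gl(N)` of the complex Lie algebra `gl(N)` of all
`N × N` matrices with the commutator bracket. -/
abbrev Ugl (N : ℕ) : Type :=
  UniversalEnvelopingAlgebra ℂ (Matrix (Fin N) (Fin N) ℂ)

/-- The matrix unit `E_{ij}`, as an element of `U gl(N)`. -/
def matrixUnit {N : ℕ} (i j : Fin N) : Ugl N :=
  UniversalEnvelopingAlgebra.ι ℂ (Matrix.single i j (1 : ℂ))

/-- The value of the `gl(N)`-weight system on a permutation `α` of `m` elements: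
`∑_{i_1, …, i_m = 1}^N E_{i_1 i_{α(1)}} ⋯ E_{i_m i_{α(m)}} ∈ U gl(N)`, where the factors of the
(noncommutative) product stand in this order. -/
def weightSystem (N : ℕ) {m : ℕ} (α : Equiv.Perm (Fin m)) : Ugl N :=
  ∑ i : Fin m → Fin N, (List.ofFn fun k : Fin m => matrixUnit (i k) (i (α k))).prod

/-- The Casimir element `C_k ∈ U gl(N)`, the value of the `gl(N)`-weight system on the standard
cycle `1 ↦ 2 ↦ ⋯ ↦ k ↦ 1`. -/
def casimir (N k : ℕ) : Ugl N := weightSystem N (finRotate k)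

/-- The standard representation `St_N : U gl(N) → Mat_N(ℂ)`: the algebra homomorphism that is the
identity on `gl(N)`. -/
def standardRep (N : ℕ) : Ugl N →ₐ[ℂ] Matrix (Fin N) (Fin N) ℂ :=
  UniversalEnvelopingAlgebra.lift ℂ (LieHom.id : Matrix (Fin N) (Fin N) ℂ →ₗ⁅ℂ⁆ _)

/-- The map `T : U gl(N) → ℂ`, `a ↦ (1/N) Tr St_N(a)`. -/
def normalizedTrace (N : ℕ) (a : Ugl N) : ℂ :=
  (N : ℂ)⁻¹ * (standardRep N a).trace

/-- The number of independent cycles of a permutation, fixed points included. -/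
def numCycles {m : ℕ} (φ : Equiv.Perm (Fin m)) : ℕ :=
  Nat.card (Quotient (Equiv.Perm.SameCycle.setoid φ))

/-- The number of faces `f(α)` of a permutation `α` of `m` elements, regarded as a hypermap with
a single vertex: the number of cycles of `α⁻¹ ∘ σ`, where `σ = (1 2 … m)` is the standard cycle.
The empty permutation (a disc without hyperedges) has one face. -/
def numFaces {m : ℕ} (α : Equiv.Perm (Fin m)) : ℕ :=
  if m = 0 then 1 else numCycles (α⁻¹ * finRotate m)

/-! ### Casimir elements are central -/

/-- The `N × N` matrix over `U gl(N)` with entries `E_{ij}`. -/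
def unitMatrix (N : ℕ) : Matrix (Fin N) (Fin N) (Ugl N) := fun i j => matrixUnit i j

theorem sum_path_eq_pow (N n : ℕ) (p q : Fin N) :
    ∑ i : Fin n → Fin N, (List.ofFn fun k : Fin (n + 1) =>
      matrixUnit ((Fin.cons p i : Fin (n + 1) → Fin N) k)
        ((Fin.snoc i q : Fin (n + 1) → Fin N) k)).prod = (unitMatrix N ^ (n + 1)) p q := by
  induction n generalizing p with
  | zero => simp [unitMatrix, Fin.snoc]
  | succ n ih =>
    rw [pow_succ', Matrix.mul_apply, ← (Fin.consEquiv fun _ => Fin N).sum_comp,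
      Fintype.sum_prod_type]
    refine Finset.sum_congr rfl fun x _ => ?_
    rw [← ih x, Finset.mul_sum]
    refine Finset.sum_congr rfl fun i _ => ?_
    have hs : (Fin.snoc ((Fin.consEquiv fun _ => Fin N) (x, i)) q : Fin (n + 2) → Fin N) =
        Fin.cons x (Fin.snoc i q : Fin (n + 1) → Fin N) :=
      (Fin.cons_snoc_eq_snoc_cons (β := Fin N) x i q).symm
    rw [List.ofFn_succ, List.prod_cons, hs]
    rfl

theorem casimir_eq_trace (N n : ℕ) : casimir N (n + 1) = (unitMatrix N ^ (n + 1)).trace := by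
  rw [casimir, weightSystem, Matrix.trace, ← (Fin.consEquiv fun _ => Fin N).sum_comp,
    Fintype.sum_prod_type]
  refine Finset.sum_congr rfl fun p _ => ?_
  rw [Matrix.diag_apply, ← sum_path_eq_pow]
  refine Finset.sum_congr rfl fun i _ => ?_
  rw [Fin.snoc_eq_cons_rotate]
  rfl

theorem matrixUnit_mul_sub {N : ℕ} (a b i j : Fin N) :
    matrixUnit a b * matrixUnit i j - matrixUnit i j * matrixUnit a b =
      (if b = i then matrixUnit a j else 0) - (if j = a then matrixUnit i b else 0) := by
  have h := (UniversalEnvelopingAlgebra.ι ℂ).map_lie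
    (Matrix.single a b (1 : ℂ)) (Matrix.single i j (1 : ℂ))
  rw [LieRing.of_associative_ring_bracket, LieRing.of_associative_ring_bracket, map_sub] at h
  unfold matrixUnit
  rw [← h]
  congr 1
  · split_ifs with hb
    · subst hb; simp
    · rw [Matrix.single_mul_single_of_ne _ _ _ _ hb, map_zero]
  · split_ifs with hb
    · subst hb; simp
    · rw [Matrix.single_mul_single_of_ne _ _ _ _ hb, map_zero]

theorem matrixUnit_mul_pow_sub {N : ℕ} (a b : Fin N) (n : ℕ) (i j : Fin N) :
    matrixUnit a b * (unitMatrix N ^ n) i j - (unitMatrix N ^ n) i j * matrixUnit a b =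
      (if b = i then (unitMatrix N ^ n) a j else 0) -
        (if j = a then (unitMatrix N ^ n) i b else 0) := by
  induction n generalizing i j with
  | zero =>
    simp only [pow_zero, Matrix.one_apply]
    by_cases h1 : i = j <;> by_cases h2 : b = i <;> by_cases h3 : j = a <;> simp_all [eq_comm]
  | succ n ih =>
    have key : ∀ x, matrixUnit a b * ((unitMatrix N ^ n) i x * unitMatrix N x j) -
        (unitMatrix N ^ n) i x * unitMatrix N x j * matrixUnit a b =
        ((if b = i then (unitMatrix N ^ n) a x else 0) -
          (if x = a then (unitMatrix N ^ n) i b else 0)) * unitMatrix N x j +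
        (unitMatrix N ^ n) i x * ((if b = x then unitMatrix N a j else 0) -
          (if j = a then unitMatrix N x b else 0)) := by
      intro x
      have h := matrixUnit_mul_sub a b x j
      rw [← ih]
      simp only [unitMatrix] at h ⊢
      rw [← h]
      noncomm_ring
    rw [pow_succ]
    simp only [Matrix.mul_apply]
    rw [Finset.mul_sum, Finset.sum_mul, ← Finset.sum_sub_distrib, Finset.sum_congr rfl
      fun x _ => key x, Finset.sum_add_distrib]
    simp only [sub_mul, mul_sub, Finset.sum_sub_distrib, ite_mul, mul_ite, zero_mul, mul_zero,
      Finset.sum_ite_eq, Finset.sum_ite_eq', Finset.mem_univ, if_true]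
    by_cases h2 : b = i <;> by_cases h3 : j = a <;>
      simp only [h2, h3, if_true, if_false, Finset.sum_const_zero] <;> abel

theorem mem_center_of_commute {N : ℕ} (z : Ugl N)
    (h : ∀ a b : Fin N, matrixUnit a b * z = z * matrixUnit a b) :
    z ∈ Subalgebra.center ℂ (Ugl N) := by
  have hι : ∀ x : Matrix (Fin N) (Fin N) ℂ, UniversalEnvelopingAlgebra.ι ℂ x ∈
      Subalgebra.centralizer ℂ ({z} : Set (Ugl N)) := by
    intro x
    rw [Matrix.matrix_eq_sum_single x, map_sum]
    refine Subalgebra.sum_mem _ fun i _ => ?_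
    rw [map_sum]
    refine Subalgebra.sum_mem _ fun j _ => ?_
    have hs : Matrix.single i j (x i j) = x i j • Matrix.single i j (1 : ℂ) := by simp
    rw [hs, map_smul]
    refine Subalgebra.smul_mem _ ?_ _
    rw [Subalgebra.mem_centralizer_iff]
    rintro _ rfl
    exact (h i j).symm
  let S := Subalgebra.centralizer ℂ ({z} : Set (Ugl N))
  let g : Matrix (Fin N) (Fin N) ℂ →ₗ⁅ℂ⁆ S :=
    { toFun := fun x => ⟨UniversalEnvelopingAlgebra.ι ℂ x, hι x⟩
      map_add' := fun x y => Subtype.ext (map_add _ x y)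
      map_smul' := fun c x => Subtype.ext (map_smul _ c x)
      map_lie' := fun {x y} => Subtype.ext (by
        exact ((UniversalEnvelopingAlgebra.ι ℂ).map_lie x y).trans
          (LieRing.of_associative_ring_bracket _ _)) }
  have hid : S.val.comp (UniversalEnvelopingAlgebra.lift ℂ g) = AlgHom.id ℂ (Ugl N) := by
    refine UniversalEnvelopingAlgebra.hom_ext ℂ (LieHom.ext fun x => ?_)
    change S.val (UniversalEnvelopingAlgebra.lift ℂ g (UniversalEnvelopingAlgebra.ι ℂ x)) =
      UniversalEnvelopingAlgebra.ι ℂ x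
    rw [UniversalEnvelopingAlgebra.lift_ι_apply]
    rfl
  rw [Subalgebra.mem_center_iff]
  intro u
  have hu : u ∈ S := by
    have := congrArg (fun f => f u) hid
    simp only [AlgHom.id_apply, AlgHom.comp_apply] at this
    rw [← this]
    exact (UniversalEnvelopingAlgebra.lift ℂ g u).2
  exact ((Subalgebra.mem_centralizer_iff ℂ).1 hu z rfl).symm

theorem casimir_mem_center (N : ℕ) (k : ℕ+) :
    casimir N k ∈ Subalgebra.center ℂ (Ugl N) := by
  obtain ⟨n, hn⟩ := Nat.exists_eq_succ_of_ne_zero k.ne_zero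
  rw [hn]
  refine mem_center_of_commute _ fun a b => ?_
  rw [← sub_eq_zero, Nat.succ_eq_add_one, casimir_eq_trace, Matrix.trace, Finset.mul_sum,
    Finset.sum_mul, ← Finset.sum_sub_distrib]
  simp only [Matrix.diag_apply, matrixUnit_mul_pow_sub, Finset.sum_sub_distrib,
    Finset.sum_ite_eq, Finset.sum_ite_eq', Finset.mem_univ, if_true, sub_self]

/-! ### The universal weight system -/

/-- The ring `ℂ[N][C_1, C_2, …]` of polynomials in the infinitely many variables `C_1, C_2, …`
whose coefficients are polynomials in the additional variable `N` (here `Polynomial.X`). -/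
abbrev CasimirRing : Type := MvPolynomial ℕ+ (Polynomial ℂ)

/-- The specialization `ℂ[N][C_1, C_2, …] → Z U gl(N)` at a given value of `N`: the variable `N`
becomes this number and the variable `C_k` becomes the Casimir element `C_k` of `U gl(N)`. -/
def specialize (N : ℕ) : CasimirRing →+* Subalgebra.center ℂ (Ugl N) :=
  MvPolynomial.eval₂Hom
    ((algebraMap ℂ (Subalgebra.center ℂ (Ugl N))).comp (Polynomial.evalRingHom (N : ℂ)))
    (fun k : ℕ+ => ⟨casimir N k, casimir_mem_center N k⟩)

/-- `w` is a universal `gl`-weight system: it assigns to each permutation a polynomial in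
`ℂ[N][C_1, C_2, …]` which, for every `N = 1, 2, …`, specializes to the value of the
`gl(N)`-weight system. -/
def IsUniversalWeightSystem (w : ∀ m : ℕ, Equiv.Perm (Fin m) → CasimirRing) : Prop :=
  ∀ N : ℕ, 0 < N → ∀ (m : ℕ) (α : Equiv.Perm (Fin m)),
    (specialize N (w m α) : Ugl N) = weightSystem N α

/-- The map `T` on `ℂ[N][C_1, C_2, …]`: the `ℂ[N]`-algebra homomorphism to `ℂ[N]` with
`C_k ↦ N^{k-1}` for `k = 1, 2, …`. -/
def universalTrace : CasimirRing →ₐ[Polynomial ℂ] Polynomial ℂ :=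
  MvPolynomial.aeval fun k : ℕ+ => (Polynomial.X : Polynomial ℂ) ^ ((k : ℕ) - 1)

end

/-! ### The standard representation -/

/-! In the standard representation `E_{px} E_{xq} = E_{pq}` for each of the `N` intermediate indices
`x`. Hence `C_k` acts as the scalar `N^{k-1}`, every polynomial in the Casimir elements acts as a
scalar, and on these `T` is a ring homomorphism (`standardRep_specialize`).

For arbitrary `α`, the product of the matrices `E_{i_k i_{α(k)}}` has trace `1` if `i ∘ α = i ∘ σ`
and `0` otherwise. The labelings with trace `1` correspond to functions on the cycles of `α⁻¹σ`, so
the trace is `N` to the number of cycles, and the factor `1/N` lowers the exponent by one. A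
universal weight system is then evaluated by comparing polynomials in `N` at all positive integers.

Existence is an induction on word length. Exchanging neighbouring factors costs a commutator, which
is a difference of two shorter words, each attached to a permutation with one point removed
(`wordWeight_swap_sub`). Therefore the factors may be reordered so that one cycle stands first; this
cycle contributes a Casimir element and splits off (`wordWeight_append`). Averaging over unused
labels in `wordWeight` lets all these words live on one fixed set `V`, so that deleting a point
never changes the type. -/

@[simp]
theorem standardRep_matrixUnit {N : ℕ} (i j : Fin N) :
    standardRep N (matrixUnit i j) = Matrix.single i j 1 := by
  rw [standardRep, matrixUnit, UniversalEnvelopingAlgebra.lift_ι_apply]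
  rfl

theorem standardRep_unitMatrix_pow (N n : ℕ) (p q : Fin N) :
    standardRep N ((unitMatrix N ^ (n + 1)) p q) = (N : ℂ) ^ n • Matrix.single p q 1 := by
  induction n generalizing q with
  | zero => simp [unitMatrix]
  | succ n ih =>
    rw [pow_succ, Matrix.mul_apply, map_sum]
    simp only [map_mul, ih, unitMatrix, standardRep_matrixUnit, smul_mul_assoc,
      Matrix.single_mul_single_same, mul_one, Finset.sum_const, Finset.card_univ,
      Fintype.card_fin, ← Nat.cast_smul_eq_nsmul ℂ, smul_smul]
    rw [pow_succ' (N : ℂ)]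

theorem standardRep_casimir (N k : ℕ) (hk : 0 < k) :
    standardRep N (casimir N k) = algebraMap ℂ _ ((N : ℂ) ^ (k - 1)) := by
  obtain ⟨n, rfl⟩ := Nat.exists_eq_succ_of_ne_zero hk.ne'
  rw [Nat.succ_eq_add_one, casimir_eq_trace, Matrix.trace, map_sum]
  simp only [Matrix.diag_apply, standardRep_unitMatrix_pow, ← Finset.smul_sum]
  rw [Nat.add_sub_cancel, Algebra.algebraMap_eq_smul_one]
  congr 1
  ext a b
  rw [Matrix.sum_apply, Matrix.one_apply]
  by_cases h : a = b
  · subst h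
    simp [Matrix.single_apply]
  · rw [if_neg h]
    refine Finset.sum_eq_zero fun c _ => Matrix.single_apply_of_ne _ _ _ _ _ ?_
    rintro ⟨rfl, rfl⟩
    exact h rfl

/-- Both sides are ring homomorphisms in `P`, so it is enough to compare them on the coefficients
and on the variables `C_k`. -/
theorem standardRep_specialize (N : ℕ) (P : CasimirRing) :
    standardRep N (specialize N P : Ugl N) =
      algebraMap ℂ _ ((universalTrace P).eval (N : ℂ)) := by
  let f : CasimirRing →+* Matrix (Fin N) (Fin N) ℂ :=
    (standardRep N).toRingHom.comp
      ((Subalgebra.center ℂ (Ugl N)).val.toRingHom.comp (specialize N))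
  let g : CasimirRing →+* Matrix (Fin N) (Fin N) ℂ :=
    (algebraMap ℂ (Matrix (Fin N) (Fin N) ℂ)).comp
      ((Polynomial.evalRingHom (N : ℂ)).comp universalTrace.toRingHom)
  have hfg : f = g := by
    refine MvPolynomial.ringHom_ext (fun r => ?_) fun k => ?_
    · change standardRep N (specialize N (MvPolynomial.C r) : Ugl N) =
        algebraMap ℂ _ ((universalTrace (MvPolynomial.C r)).eval (N : ℂ))
      simp only [specialize, universalTrace, MvPolynomial.coe_eval₂Hom, MvPolynomial.eval₂_C,
        MvPolynomial.aeval_C]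
      exact (standardRep N).commutes _
    · change standardRep N (specialize N (MvPolynomial.X k) : Ugl N) =
        algebraMap ℂ _ ((universalTrace (MvPolynomial.X k)).eval (N : ℂ))
      simp only [specialize, universalTrace, MvPolynomial.coe_eval₂Hom, MvPolynomial.eval₂_X,
        MvPolynomial.aeval_X, standardRep_casimir N k k.pos, Polynomial.eval_pow,
        Polynomial.eval_X]
  exact congrArg (fun h => h P) hfg

theorem normalizedTrace_of_scalar {N : ℕ} (hN : 0 < N) {a : Ugl N} {c : ℂ}
    (h : standardRep N a = algebraMap ℂ _ c) : normalizedTrace N a = c := by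
  have hN' : (N : ℂ) ≠ 0 := Nat.cast_ne_zero.2 hN.ne'
  rw [normalizedTrace, h, Algebra.algebraMap_eq_smul_one, Matrix.trace_smul, Matrix.trace_one,
    Fintype.card_fin, smul_eq_mul]
  field_simp

/-! ### Counting labelings -/

theorem prod_ofFn_single {N : ℕ} (n : ℕ) (a b : Fin (n + 1) → Fin N) [Decidable
    (∀ k : Fin n, b k.castSucc = a k.succ)] :
    (List.ofFn fun k => Matrix.single (a k) (b k) (1 : ℂ)).prod =
      if ∀ k : Fin n, b k.castSucc = a k.succ then Matrix.single (a 0) (b (Fin.last n)) 1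
      else 0 := by
  classical
  induction n with
  | zero => simp
  | succ n ih =>
    rw [List.ofFn_succ, List.prod_cons, ih (fun k => a k.succ) (fun k => b k.succ)]
    simp only [Fin.forall_fin_succ (n := n), Fin.castSucc_zero, Fin.succ_zero_eq_one,
      ← Fin.succ_castSucc, Fin.succ_last]
    by_cases h1 : b 0 = a 1
    · by_cases h2 : ∀ k : Fin n, b k.castSucc.succ = a k.succ.succ
      · rw [if_pos h2, if_pos ⟨h1, h2⟩, h1]
        simp
      · rw [if_neg h2, if_neg fun h => h2 h.2, mul_zero]
    · refine Eq.trans ?_ (if_neg fun h => h1 h.1).symm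
      split_ifs
      · exact Matrix.single_mul_single_of_ne _ _ _ _ h1 _
      · exact mul_zero _

/-- Consecutive indices must match for the product to be nonzero, and the trace adds the match of
the last with the first. Together these conditions close up cyclically, which is how the standard
cycle enters. -/
theorem trace_prod_ofFn_single {N : ℕ} (n : ℕ) (a b : Fin (n + 1) → Fin N)
    [Decidable (∀ k, b k = a (finRotate (n + 1) k))] :
    ((List.ofFn fun k => Matrix.single (a k) (b k) (1 : ℂ)).prod).trace =
      if ∀ k, b k = a (finRotate (n + 1) k) then 1 else 0 := by
  classical
  have hiff : (∀ k, b k = a (finRotate (n + 1) k)) ↔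
      (∀ k : Fin n, b k.castSucc = a k.succ) ∧ b (Fin.last n) = a 0 := by
    rw [Fin.forall_fin_succ']
    simp
  rw [prod_ofFn_single]
  simp only [hiff]
  by_cases h1 : ∀ k : Fin n, b k.castSucc = a k.succ
  · rw [if_pos h1]
    by_cases h2 : b (Fin.last n) = a 0
    · rw [if_pos ⟨h1, h2⟩, h2, Matrix.trace_single_eq_same]
    · rw [if_neg fun h => h2 h.2, Matrix.trace_single_eq_of_ne _ _ _ (Ne.symm h2)]
  · rw [if_neg h1, if_neg fun h => h1 h.1, Matrix.trace_zero]

/-- An invariant labeling is constant on cycles, hence a function on the quotient by `SameCycle`. -/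
theorem card_invariant_labelings {m : ℕ} (N : ℕ) (φ : Equiv.Perm (Fin m)) :
    Nat.card {j : Fin m → Fin N // ∀ k, j (φ k) = j k} = N ^ numCycles φ := by
  have hpow : ∀ j : Fin m → Fin N, (∀ k, j (φ k) = j k) → ∀ x y, φ.SameCycle x y →
      j x = j y := by
    rintro j hj x _ ⟨n, rfl⟩
    induction n using Int.induction_on with
    | zero => rfl
    | succ n ih => rw [ih, add_comm, zpow_add, zpow_one, Equiv.Perm.mul_apply, hj]
    | pred n ih =>
      rw [ih, sub_eq_neg_add, zpow_add, zpow_neg_one, Equiv.Perm.mul_apply,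
        ← hj (φ⁻¹ _), ← Equiv.Perm.mul_apply φ, mul_inv_cancel, Equiv.Perm.one_apply]
  let e : {j : Fin m → Fin N // ∀ k, j (φ k) = j k} ≃
      (Quotient (Equiv.Perm.SameCycle.setoid φ) → Fin N) :=
    { toFun := fun j q => Quotient.lift j.1 (hpow j.1 j.2) q
      invFun := fun f => ⟨fun k => f (Quotient.mk _ k), fun k =>
        congrArg f (Quotient.sound (Equiv.Perm.sameCycle_apply_left.2
          (Equiv.Perm.SameCycle.refl φ k)))⟩
      left_inv := fun j => rfl
      right_inv := fun f => funext fun q => by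
        induction q using Quotient.inductionOn
        rfl }
  rw [Nat.card_congr e, Nat.card_fun, Nat.card_fin, numCycles]

theorem card_labelings_eq_rotate {m : ℕ} (N : ℕ) (α σ : Equiv.Perm (Fin m)) :
    Nat.card {i : Fin m → Fin N // ∀ k, i (α k) = i (σ k)} = N ^ numCycles (α⁻¹ * σ) := by
  rw [← card_invariant_labelings]
  -- The substitution `j = i ∘ α` turns the condition into invariance of `j` under `α⁻¹ * σ`.
  refine Nat.card_congr ((Equiv.arrowCongr α.symm (Equiv.refl _)).subtypeEquiv fun i => ?_)
  simp [Equiv.arrowCongr_apply, eq_comm]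

theorem trace_standardRep_weightSystem {n : ℕ} (N : ℕ) (α : Equiv.Perm (Fin (n + 1))) :
    (standardRep N (weightSystem N α)).trace =
      (N : ℂ) ^ numCycles (α⁻¹ * finRotate (n + 1)) := by
  classical
  rw [weightSystem, map_sum, Matrix.trace_sum]
  simp only [map_list_prod, List.map_ofFn, Function.comp_def, standardRep_matrixUnit,
    trace_prod_ofFn_single]
  rw [Finset.sum_boole, ← Nat.cast_pow, ← card_labelings_eq_rotate, Nat.card_eq_fintype_card,
    Fintype.card_subtype]

/-! ### Faces and the values of `T` -/

theorem numFaces_pos {m : ℕ} (α : Equiv.Perm (Fin m)) : 1 ≤ numFaces α := by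
  rw [numFaces]
  split_ifs with h
  · exact le_rfl
  · have : Nonempty (Fin m) := ⟨⟨0, Nat.pos_of_ne_zero h⟩⟩
    have : Nonempty (Quotient (Equiv.Perm.SameCycle.setoid (α⁻¹ * finRotate m))) :=
      this.map (Quotient.mk _)
    exact Nat.card_pos

theorem normalizedTrace_weightSystem {m N : ℕ} (hN : 0 < N) (α : Equiv.Perm (Fin m)) :
    normalizedTrace N (weightSystem N α) = (N : ℂ) ^ (numFaces α - 1) := by
  have hN' : (N : ℂ) ≠ 0 := Nat.cast_ne_zero.2 hN.ne'
  cases m with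
  | zero =>
    refine normalizedTrace_of_scalar hN ?_
    simp [weightSystem, numFaces]
  | succ n =>
    have h := numFaces_pos α
    rw [numFaces, if_neg n.succ_ne_zero] at h ⊢
    rw [normalizedTrace, trace_standardRep_weightSystem, inv_mul_eq_iff_eq_mul₀ hN',
      ← pow_succ', Nat.sub_add_cancel h]

theorem universalTrace_of_isUniversalWeightSystem
    {w : ∀ m : ℕ, Equiv.Perm (Fin m) → CasimirRing} (hw : IsUniversalWeightSystem w) (m : ℕ)
    (α : Equiv.Perm (Fin m)) :
    universalTrace (w m α) = (Polynomial.X : Polynomial ℂ) ^ (numFaces α - 1) := by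
  -- The comparison points are `n + 1`, because the specialization is only controlled for positive
  -- `N`.
  refine Polynomial.eq_of_infinite_eval_eq _ _ (Set.Infinite.mono ?_
    (Set.infinite_range_of_injective (f := fun n : ℕ => ((n + 1 : ℕ) : ℂ)) fun a b h => by
      simpa using h))
  rintro _ ⟨n, rfl⟩
  change Polynomial.eval _ _ = Polynomial.eval _ _
  rw [Polynomial.eval_pow, Polynomial.eval_X, ← normalizedTrace_weightSystem n.succ_pos α,
    ← hw _ n.succ_pos]
  exact (normalizedTrace_of_scalar n.succ_pos (standardRep_specialize _ _)).symm

/-! ### Sums over labelings -/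

section Labelings

variable {V ι A M : Type*} [Fintype V] [Fintype ι] [Fintype A] [DecidableEq V] [DecidableEq ι]

/-- Exchanging `j` with the restriction of `i` along `e` is an involution on pairs `(i, j)`.
Counting pairs on both sides avoids division and complements; the same device, exchanging one label
or all labels outside `s`, gives the update and product lemmas below. -/
theorem sum_labelings_comp_injective [AddCommMonoid M] {e : ι → V} (he : Function.Injective e)
    (f : (ι → A) → M) :
    Fintype.card A ^ Fintype.card ι • ∑ i : V → A, f (i ∘ e) =
      Fintype.card A ^ Fintype.card V • ∑ j : ι → A, f j := by
  have hs : Function.Involutive fun p : (V → A) × (ι → A) =>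
      (Function.extend e p.2 p.1, p.1 ∘ e) := by
    rintro ⟨i, j⟩
    refine Prod.ext (funext fun v => ?_) (funext fun k => he.extend_apply _ _ _)
    by_cases hv : ∃ k, e k = v
    · obtain ⟨k, rfl⟩ := hv
      exact he.extend_apply _ _ _
    · exact (Function.extend_apply' _ _ _ hv).trans (Function.extend_apply' _ _ _ hv)
  have h := Equiv.sum_comp hs.toPerm fun p : (V → A) × (ι → A) => f p.2
  simp only [Function.Involutive.coe_toPerm] at h
  rw [Fintype.sum_prod_type, Fintype.sum_prod_type] at h
  simpa [Finset.smul_sum] using h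

theorem sum_labelings_update [AddCommMonoid M] (b : V) (F : (V → A) → M) :
    ∑ i : V → A, ∑ t : A, F (Function.update i b t) = Fintype.card A • ∑ i : V → A, F i := by
  have hs : Function.Involutive fun p : (V → A) × A => (Function.update p.1 b p.2, p.1 b) := by
    rintro ⟨i, t⟩
    simp
  have h := Equiv.sum_comp hs.toPerm fun p : (V → A) × A => F p.1
  simp only [Function.Involutive.coe_toPerm] at h
  rw [Fintype.sum_prod_type, Fintype.sum_prod_type] at h
  simpa [Finset.smul_sum] using h

/-- Since `f` ignores the label at `b`, the constraint just selects one of the `|A|` values of that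
label. -/
theorem sum_labelings_eq_of_ne [AddCommMonoid M] [DecidableEq A] {b c : V} (hbc : c ≠ b)
    {f : (V → A) → M} (hf : ∀ i t, f (Function.update i b t) = f i) :
    Fintype.card A • ∑ i : V → A, (if i b = i c then f i else 0) = ∑ i : V → A, f i := by
  rw [← sum_labelings_update b]
  simp [hf, hbc]

theorem sum_labelings_mul [Semiring M] (s : Finset V) {f g : (V → A) → M}
    (hf : ∀ i j, f (s.piecewise i j) = f i) (hg : ∀ i j, g (s.piecewise i j) = g j) :
    (∑ i : V → A, f i) * ∑ i : V → A, g i =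
      Fintype.card A ^ Fintype.card V • ∑ i : V → A, f i * g i := by
  have hs : Function.Involutive fun p : (V → A) × (V → A) =>
      (s.piecewise p.1 p.2, s.piecewise p.2 p.1) := by
    rintro ⟨i, j⟩
    simp [Finset.piecewise_same]
  have h := Equiv.sum_comp hs.toPerm fun p : (V → A) × (V → A) => f p.1 * g p.1
  simp only [Function.Involutive.coe_toPerm, hf, hg] at h
  rw [Fintype.sum_prod_type, Fintype.sum_prod_type] at h
  rw [Finset.sum_mul_sum, h]
  simp [Finset.smul_sum]

end Labelings

/-! ### Words indexed by invariant lists -/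

/-- A family of elements of `U gl(N)` is universal if, for all `N ≥ 1`, it consists of the
specializations of one polynomial in `N` and the Casimir elements. -/
def IsUniversal (z : ∀ N : ℕ, Ugl N) : Prop :=
  ∃ P : CasimirRing, ∀ N : ℕ, 0 < N → (specialize N P : Ugl N) = z N

namespace IsUniversal

variable {y z : ∀ N : ℕ, Ugl N}

theorem congr (hz : IsUniversal z) (h : ∀ N, 0 < N → y N = z N) : IsUniversal y := by
  obtain ⟨P, hP⟩ := hz
  exact ⟨P, fun N hN => (hP N hN).trans (h N hN).symm⟩

theorem one : IsUniversal fun _ => 1 := ⟨1, fun N _ => by simp⟩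

theorem add (hy : IsUniversal y) (hz : IsUniversal z) : IsUniversal fun N => y N + z N := by
  obtain ⟨P, hP⟩ := hy
  obtain ⟨Q, hQ⟩ := hz
  exact ⟨P + Q, fun N hN => by simp [hP N hN, hQ N hN]⟩

theorem sub (hy : IsUniversal y) (hz : IsUniversal z) : IsUniversal fun N => y N - z N := by
  obtain ⟨P, hP⟩ := hy
  obtain ⟨Q, hQ⟩ := hz
  exact ⟨P - Q, fun N hN => by simp [hP N hN, hQ N hN]⟩

theorem mul (hy : IsUniversal y) (hz : IsUniversal z) : IsUniversal fun N => y N * z N := by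
  obtain ⟨P, hP⟩ := hy
  obtain ⟨Q, hQ⟩ := hz
  exact ⟨P * Q, fun N hN => by simp [hP N hN, hQ N hN]⟩

theorem natCast_smul (hz : IsUniversal z) : IsUniversal fun N => (N : ℂ) • z N := by
  obtain ⟨P, hP⟩ := hz
  refine ⟨MvPolynomial.C Polynomial.X * P, fun N hN => ?_⟩
  change _ = (N : ℂ) • z N
  rw [map_mul, ← hP N hN, Algebra.smul_def]
  simp only [specialize, MvPolynomial.coe_eval₂Hom, MvPolynomial.eval₂_C, MulMemClass.coe_mul]
  simp

theorem casimir {k : ℕ} (hk : 0 < k) : IsUniversal fun N => casimir N k :=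
  ⟨MvPolynomial.X (k.toPNat hk), fun N _ => by
    rw [specialize, MvPolynomial.coe_eval₂Hom, MvPolynomial.eval₂_X]
    rfl⟩

end IsUniversal

/-- The enumeration is `j ↦ α^j x` below the minimal period of `x`. In this order `α` acts as
`finRotate k`, so the word of the cycle is that of `C_k`. -/
theorem exists_cycle_enumeration {V : Type*} [Finite V] (α : Equiv.Perm V) (x : V) :
    ∃ (k : ℕ) (e : Fin k → V), 0 < k ∧ Function.Injective e ∧
      (∀ j, α (e j) = e (finRotate k j)) ∧ ∀ y, y ∈ List.ofFn e ↔ α.SameCycle x y := by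
  have hpos : 0 < Function.minimalPeriod α x :=
    Function.minimalPeriod_pos_of_mem_periodicPts
      (Function.Injective.mem_periodicPts α.injective x)
  obtain ⟨n, hn⟩ := Nat.exists_eq_succ_of_ne_zero hpos.ne'
  refine ⟨n + 1, fun j => α^[j] x, n.succ_pos, fun a b hab => Fin.ext ?_, fun j => ?_,
    fun y => ?_⟩
  · exact Function.iterate_injOn_Iio_minimalPeriod (f := α) (x := x) (by simp [hn, a.is_le])
      (by simp [hn, b.is_le]) hab
  · rw [← Function.iterate_succ_apply' (⇑α)]
    induction j using Fin.lastCases with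
    | last =>
      rw [finRotate_last, Fin.val_last, ← hn, Function.iterate_minimalPeriod]
      rfl
    | cast j => simp
  · rw [List.mem_ofFn]
    constructor
    · rintro ⟨j, rfl⟩
      exact ⟨j, by simp [Equiv.Perm.iterate_eq_pow]⟩
    · intro h
      obtain ⟨m, hm⟩ := h.exists_nat_pow_eq
      refine ⟨⟨m % (n + 1), Nat.mod_lt _ n.succ_pos⟩, ?_⟩
      change α^[m % (n + 1)] x = y
      rw [← Nat.succ_eq_add_one, ← hn, Function.iterate_mod_minimalPeriod_eq,
        Equiv.Perm.iterate_eq_pow, hm]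

section Words

variable {V : Type*}

/-- The product of the elements `E_{i(k) i(α(k))}` over the entries `k` of a list. -/
def labelWord {N : ℕ} (α : Equiv.Perm V) (L : List V) (i : V → Fin N) : Ugl N :=
  (L.map fun k => matrixUnit (i k) (i (α k))).prod

theorem labelWord_append {N : ℕ} (α : Equiv.Perm V) (L L' : List V) (i : V → Fin N) :
    labelWord α (L ++ L') i = labelWord α L i * labelWord α L' i := by
  simp [labelWord]

theorem labelWord_cons {N : ℕ} (α : Equiv.Perm V) (a : V) (L : List V) (i : V → Fin N) :
    labelWord α (a :: L) i = matrixUnit (i a) (i (α a)) * labelWord α L i := by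
  simp [labelWord]

theorem labelWord_congr {N : ℕ} {α β : Equiv.Perm V} {L : List V} {i j : V → Fin N}
    (h : ∀ k ∈ L, i k = j k ∧ i (α k) = j (β k)) : labelWord α L i = labelWord β L j := by
  rw [labelWord, labelWord, List.map_congr_left fun k hk => by rw [(h k hk).1, (h k hk).2]]

variable [DecidableEq V]

/-- Removing the point `b` from its cycle. -/
def skipPoint (γ : Equiv.Perm V) (b : V) : Equiv.Perm V := Equiv.swap b (γ b) * γ

theorem skipPoint_mem (α : Equiv.Perm V) {l₁ l₂ : List V} {a b : V}
    (hnd : (l₁ ++ a :: b :: l₂).Nodup)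
    (hα : ∀ x ∈ l₁ ++ a :: b :: l₂, α x ∈ l₁ ++ a :: b :: l₂) :
    ∀ x ∈ l₁ ++ a :: l₂, skipPoint (α * Equiv.swap a b) b x ∈ l₁ ++ a :: l₂ := by
  have hnd' : (b :: (l₁ ++ a :: l₂)).Nodup := by
    refine (List.Perm.nodup_iff ?_).1 hnd
    refine (List.Perm.append_left l₁ (List.Perm.swap b a l₂)).trans List.perm_middle
  have hmem : ∀ y, y ∈ l₁ ++ a :: l₂ ↔ y ∈ l₁ ++ a :: b :: l₂ ∧ y ≠ b := fun y => by
    have := (List.nodup_cons.1 hnd').1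
    by_cases hy : y = b
    · subst hy
      simp only [this, false_iff, not_and, ne_eq, not_true_eq_false, not_false_eq_true,
        implies_true]
    · simp [hy]
  set S := l₁ ++ a :: b :: l₂ with hS
  have ha : a ∈ S := by simp [hS]
  have hb : b ∈ S := by simp [hS]
  have hsw : ∀ {c d : V}, c ∈ S → d ∈ S → ∀ x ∈ S, Equiv.swap c d x ∈ S :=
    fun hc hd x hx => by
      rw [Equiv.swap_apply_def]
      split_ifs <;> assumption
  intro x hx
  rw [hmem] at hx ⊢
  obtain ⟨hxS, hxb⟩ := hx
  have hγ : ∀ y ∈ S, (α * Equiv.swap a b) y ∈ S := fun y hy => hα _ (hsw ha hb y hy)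
  -- Membership survives because `γ` and the swap preserve `S`; `b` is fixed by `skipPoint`, so by
  -- injectivity no other point reaches it.
  refine ⟨hsw hb (hγ b hb) _ (hγ x hxS), fun h => hxb ?_⟩
  rw [skipPoint, Equiv.Perm.mul_apply, Equiv.swap_apply_eq_iff, Equiv.swap_apply_left] at h
  exact (α * Equiv.swap a b).injective h

variable [Fintype V]

/-- The sum of the words `labelWord α L i` over the labelings `i`, where the labels of points
outside `L` are averaged instead of summed. -/
noncomputable def wordWeight (N : ℕ) (α : Equiv.Perm V) (L : List V) : Ugl N :=
  ((N : ℂ) ^ L.length * ((N : ℂ) ^ Fintype.card V)⁻¹) • ∑ i : V → Fin N, labelWord α L i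

theorem wordWeight_nil {N : ℕ} (hN : 0 < N) (α : Equiv.Perm V) : wordWeight N α [] = 1 := by
  have hN' : (N : ℂ) ≠ 0 := Nat.cast_ne_zero.2 hN.ne'
  simp only [wordWeight, labelWord, List.length_nil, List.map_nil, List.prod_nil,
    Finset.sum_const, Finset.card_univ, Fintype.card_fun, Fintype.card_fin, pow_zero, one_mul]
  rw [← Nat.cast_smul_eq_nsmul ℂ, smul_smul, Nat.cast_pow, inv_mul_cancel₀ (pow_ne_zero _ hN'),
    one_smul]

theorem wordWeight_ofFn {N k : ℕ} (hN : 0 < N) (α : Equiv.Perm V) (β : Equiv.Perm (Fin k))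
    {e : Fin k → V} (he : Function.Injective e) (h : ∀ j, α (e j) = e (β j)) :
    wordWeight N α (List.ofFn e) = weightSystem N β := by
  have hN' : (N : ℂ) ≠ 0 := Nat.cast_ne_zero.2 hN.ne'
  have hs := sum_labelings_comp_injective he fun j : Fin k → Fin N =>
    (List.ofFn fun k => matrixUnit (j k) (j (β k))).prod
  simp only [Fintype.card_fin, ← Nat.cast_smul_eq_nsmul ℂ, Nat.cast_pow] at hs
  have hw : ∀ i : V → Fin N, labelWord α (List.ofFn e) i =
      (List.ofFn fun k => matrixUnit ((i ∘ e) k) ((i ∘ e) (β k))).prod := fun i => by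
    simp [labelWord, List.map_ofFn, Function.comp_def, h]
  simp only [wordWeight, hw]
  rw [mul_comm, mul_smul, List.length_ofFn, hs, smul_smul,
    inv_mul_cancel₀ (pow_ne_zero _ hN'), one_smul, weightSystem]

theorem wordWeight_append {N : ℕ} (hN : 0 < N) (α : Equiv.Perm V) {L L' : List V}
    (hd : L.Disjoint L') (hL : ∀ x ∈ L, α x ∈ L) (hL' : ∀ x ∈ L', α x ∈ L') :
    wordWeight N α (L ++ L') = wordWeight N α L * wordWeight N α L' := by
  have hN' : (N : ℂ) ≠ 0 := Nat.cast_ne_zero.2 hN.ne'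
  have h := sum_labelings_mul (A := Fin N) L.toFinset (f := labelWord α L) (g := labelWord α L')
    (fun i j => labelWord_congr fun k hk =>
      ⟨Finset.piecewise_eq_of_mem _ _ _ (List.mem_toFinset.2 hk),
        Finset.piecewise_eq_of_mem _ _ _ (List.mem_toFinset.2 (hL k hk))⟩)
    (fun i j => labelWord_congr fun k hk =>
      ⟨Finset.piecewise_eq_of_notMem _ _ _ fun hm => hd (List.mem_toFinset.1 hm) hk,
        Finset.piecewise_eq_of_notMem _ _ _ fun hm => hd (List.mem_toFinset.1 hm) (hL' k hk)⟩)
  simp only [Fintype.card_fin, ← Nat.cast_smul_eq_nsmul ℂ, Nat.cast_pow] at h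
  simp only [wordWeight, smul_mul_smul_comm, h, smul_smul, labelWord_append, List.length_append]
  congr 1
  rw [pow_add]
  field_simp

/-- If `γ` fixes `b`, the constraint is vacuous and a free label leaves the factor `N`. Otherwise,
under the constraint `γ` may be replaced by `skipPoint γ b`, after which the word no longer sees the
label at `b`. -/
theorem sum_labelWord_contract {N : ℕ} (γ : Equiv.Perm V) {b : V} {L : List V} (hb : b ∉ L) :
    (N : ℂ) • ∑ i : V → Fin N, (if i b = i (γ b) then labelWord γ L i else 0) =
      (if γ b = b then (N : ℂ) else 1) • ∑ i : V → Fin N, labelWord (skipPoint γ b) L i := by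
  by_cases hc : γ b = b
  · have hskip : skipPoint γ b = γ := by
      rw [skipPoint, hc, Equiv.swap_self]
      exact one_mul γ
    simp [hc, hskip]
  · have hskip : ∀ i : V → Fin N, i b = i (γ b) → labelWord γ L i =
        labelWord (skipPoint γ b) L i := fun i hi => by
      refine labelWord_congr fun k _ => ⟨rfl, ?_⟩
      rw [skipPoint, Equiv.Perm.mul_apply, Equiv.swap_apply_def]
      split_ifs with h1 h2
      · rw [h1, hi]
      · rw [h2, hi]
      · rfl
    have hind : ∀ (i : V → Fin N) (t : Fin N), labelWord (skipPoint γ b) L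
        (Function.update i b t) = labelWord (skipPoint γ b) L i := fun i t => by
      refine labelWord_congr fun k hk => ?_
      have hkb : k ≠ b := fun h => hb (h ▸ hk)
      refine ⟨Function.update_of_ne hkb _ _, Function.update_of_ne (fun h => hkb ?_) _ _⟩
      rw [skipPoint, Equiv.Perm.mul_apply, Equiv.swap_apply_eq_iff, Equiv.swap_apply_left] at h
      exact γ.injective h
    rw [if_neg hc, one_smul, ← sum_labelings_eq_of_ne hc hind, Fintype.card_fin,
      Nat.cast_smul_eq_nsmul ℂ]
    congr 1
    refine Finset.sum_congr rfl fun i _ => ?_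
    split_ifs with hi
    · exact hskip i hi
    · rfl

/-- Each term of the commutator of two matrix units merges `a` and `b` into one factor whose target
is that of the other point, which is the effect of composing `α` with the swap. The remaining
Kronecker delta is contracted by `sum_labelWord_contract`. -/
theorem wordWeight_swap_sub (N : ℕ) (α : Equiv.Perm V) {l₁ l₂ : List V} {a b : V}
    (hnd : (l₁ ++ a :: b :: l₂).Nodup) :
    wordWeight N α (l₁ ++ a :: b :: l₂) - wordWeight N α (l₁ ++ b :: a :: l₂) =
      (if α a = b then (N : ℂ) else 1) •
        wordWeight N (skipPoint (α * Equiv.swap a b) b) (l₁ ++ a :: l₂) -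
      (if α b = a then (N : ℂ) else 1) •
        wordWeight N (skipPoint (α * Equiv.swap b a) a) (l₁ ++ b :: l₂) := by
  have hnd' : (a :: b :: (l₁ ++ l₂)).Nodup := by
    refine (List.Perm.nodup_iff ?_).1 hnd
    exact List.perm_middle.trans (List.Perm.cons a List.perm_middle)
  simp only [List.nodup_cons, List.mem_cons, List.mem_append, not_or] at hnd'
  obtain ⟨⟨hab, ha₁, ha₂⟩, ⟨hb₁, hb₂⟩, -⟩ := hnd'
  have hout : ∀ {a b : V} (l : List V) (i : V → Fin N), a ∉ l → b ∉ l →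
      labelWord (α * Equiv.swap a b) l i = labelWord α l i := fun l i ha hb =>
    labelWord_congr fun k hk => ⟨rfl, by
      rw [Equiv.Perm.mul_apply, Equiv.swap_apply_of_ne_of_ne (ne_of_mem_of_not_mem hk ha)
        (ne_of_mem_of_not_mem hk hb)]⟩
  have hterm : ∀ i : V → Fin N, labelWord α (l₁ ++ a :: b :: l₂) i -
      labelWord α (l₁ ++ b :: a :: l₂) i =
      (if i b = i ((α * Equiv.swap a b) b) then
        labelWord (α * Equiv.swap a b) (l₁ ++ a :: l₂) i else 0) -
      (if i a = i ((α * Equiv.swap b a) a) then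
        labelWord (α * Equiv.swap b a) (l₁ ++ b :: l₂) i else 0) := fun i => by
    simp only [labelWord_append, labelWord_cons, hout l₁ i ha₁ hb₁, hout l₂ i ha₂ hb₂,
      hout l₁ i hb₁ ha₁, hout l₂ i hb₂ ha₂, Equiv.Perm.mul_apply, Equiv.swap_apply_left,
      Equiv.swap_apply_right]
    have h := matrixUnit_mul_sub (i a) (i (α a)) (i b) (i (α b))
    have h' : ∀ u v x y : Ugl N, u * (x * (y * v)) - u * (y * (x * v)) =
        u * (x * y - y * x) * v := fun u v x y => by noncomm_ring
    rw [h', h]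
    simp only [eq_comm (a := i b) (b := i (α a)), eq_comm (a := i a) (b := i (α b))]
    split_ifs <;> noncomm_ring
  have hba : b ∉ l₁ ++ a :: l₂ := by simp [hb₁, hb₂, Ne.symm hab]
  have hab' : a ∉ l₁ ++ b :: l₂ := by simp [ha₁, ha₂, hab]
  have h₁ := sum_labelWord_contract (N := N) (α * Equiv.swap a b) hba
  have h₂ := sum_labelWord_contract (N := N) (α * Equiv.swap b a) hab'
  have e₁ : (α * Equiv.swap a b) b = α a := by simp
  have e₂ : (α * Equiv.swap b a) a = α b := by simp
  simp only [wordWeight]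
  rw [smul_comm (if α a = b then (N : ℂ) else 1), smul_comm (if α b = a then (N : ℂ) else 1)]
  simp only [List.length_append, List.length_cons]
  rw [← smul_sub, ← smul_sub, ← Finset.sum_sub_distrib, Finset.sum_congr rfl fun i _ => hterm i,
    Finset.sum_sub_distrib]
  rw [e₁] at h₁
  rw [e₂] at h₂
  -- The factor `N` on the contracted side makes up for the words being one letter shorter in the
  -- normalization.
  rw [e₁, e₂, ← h₁, ← h₂, ← smul_sub, smul_smul]
  congr 1
  ring

/-- Universality of the weights does not depend on the order of a list, provided that it is known
for shorter lists. -/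
theorem isUniversal_wordWeight_of_perm {n : ℕ}
    (ih : ∀ (L : List V) (α : Equiv.Perm V), L.length < n → L.Nodup → (∀ x ∈ L, α x ∈ L) →
      IsUniversal fun N => wordWeight N α L) (α : Equiv.Perm V) {L L' : List V}
    (hp : L.Perm L') : ∀ l : List V, (l ++ L).length = n → (l ++ L).Nodup →
      (∀ x ∈ l ++ L, α x ∈ l ++ L) → (IsUniversal fun N => wordWeight N α (l ++ L)) →
      IsUniversal fun N => wordWeight N α (l ++ L') := by
  induction hp with
  | nil => exact fun l _ _ _ h => h
  -- The prefix `l` absorbs the common head, so that swaps occur at any position.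
  | cons x _ ih' =>
    intro l hn hnd hα h
    have := ih' (l ++ [x])
    simp only [List.append_assoc, List.singleton_append] at this
    exact this hn hnd hα h
  | swap a b l₂ =>
    intro l hn hnd hα h
    have hp : (l ++ b :: a :: l₂).Perm (l ++ a :: b :: l₂) :=
      List.Perm.append_left l (List.Perm.swap a b l₂)
    -- The choice between `N` and `1` depends on `α` only, so a single polynomial serves every `N`.
    have hscale : ∀ (p : Prop) [Decidable p] {z : ∀ N, Ugl N}, IsUniversal z →
        IsUniversal fun N => (if p then (N : ℂ) else 1) • z N := fun p _ z hz => by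
      split_ifs
      · exact hz.natCast_smul
      · simpa using hz
    have hdel : ∀ {a b : V}, (l ++ b :: a :: l₂).Perm (l ++ a :: b :: l₂) →
        (l ++ b :: a :: l₂).length = n → (l ++ b :: a :: l₂).Nodup →
        (∀ x ∈ l ++ b :: a :: l₂, α x ∈ l ++ b :: a :: l₂) →
        IsUniversal fun N =>
          wordWeight N (skipPoint (α * Equiv.swap b a) a) (l ++ b :: l₂) :=
      fun hp hn hnd hα => by
        refine ih _ _ ?_ ?_ (skipPoint_mem α hnd hα)
        · rw [← hn]
          simp
        · exact hnd.sublist (List.Sublist.append_left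
            (List.Sublist.cons_cons _ (List.sublist_cons_self _ _)) _)
    have hα' : ∀ x ∈ l ++ a :: b :: l₂, α x ∈ l ++ a :: b :: l₂ :=
      fun x hx => hp.mem_iff.1 (hα x (hp.mem_iff.2 hx))
    refine ((h.sub (hscale (α b = a) (hdel hp hn hnd hα))).add (hscale (α a = b)
      (hdel hp.symm (hp.length_eq ▸ hn) (hp.nodup_iff.1 hnd) hα'))).congr fun N _ => ?_
    have := wordWeight_swap_sub N α hnd
    rw [sub_eq_iff_eq_add] at this
    rw [this]
    abel
  | trans hp _ ih₁ ih₂ =>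
    intro l hn hnd hα h
    have hp' := List.Perm.append_left l hp
    exact ih₂ l (hp'.length_eq ▸ hn) (hp'.nodup_iff.1 hnd)
      (fun x hx => hp'.mem_iff.1 (hα x (hp'.mem_iff.2 hx))) (ih₁ l hn hnd hα h)

theorem isUniversal_wordWeight (L : List V) (α : Equiv.Perm V) (hnd : L.Nodup)
    (hα : ∀ x ∈ L, α x ∈ L) : IsUniversal fun N => wordWeight N α L := by
  classical
  induction hn : L.length using Nat.strong_induction_on generalizing L α with
  | _ n ih =>
    cases L with
    | nil => exact IsUniversal.one.congr fun N hN => wordWeight_nil hN α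
    | cons x L₀ =>
      obtain ⟨k, e, hk, he, hrot, hmem⟩ := exists_cycle_enumeration α x
      set L := x :: L₀
      have hiter : ∀ y, α.SameCycle x y → y ∈ L := fun y hy => by
        obtain ⟨m, rfl⟩ := hy.exists_nat_pow_eq
        induction m with
        | zero => simp [L]
        | succ m ihm =>
          rw [pow_succ', Equiv.Perm.mul_apply]
          exact hα _ (ihm ⟨m, by simp⟩)
      -- What remains of the list once the cycle of its head is removed is shorter and still
      -- invariant.
      set L' := L.filter fun y => ¬ α.SameCycle x y
      have hd : (List.ofFn e).Disjoint L' := fun y hy hy' => by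
        have := (List.mem_filter.1 hy').2
        simp only [decide_eq_true_eq] at this
        exact this ((hmem y).1 hy)
      have hL' : L'.Nodup := hnd.filter _
      have hCnd : (List.ofFn e ++ L').Nodup :=
        List.Nodup.append (List.nodup_ofFn.2 he) hL' hd
      have hp : (List.ofFn e ++ L').Perm L := by
        refine (List.perm_ext_iff_of_nodup hCnd hnd).2 fun y => ?_
        simp only [List.mem_append, hmem, L', List.mem_filter, decide_eq_true_eq]
        by_cases hy : α.SameCycle x y
        · simp [hy, hiter y hy]
        · simp [hy]
      have hα₁ : ∀ y ∈ List.ofFn e, α y ∈ List.ofFn e := fun y hy =>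
        (hmem _).2 (Equiv.Perm.sameCycle_apply_right.2 ((hmem y).1 hy))
      have hα₂ : ∀ y ∈ L', α y ∈ L' := fun y hy => by
        simp only [L', List.mem_filter, decide_eq_true_eq] at hy ⊢
        exact ⟨hα y hy.1, fun h => hy.2 (Equiv.Perm.sameCycle_apply_right.1 h)⟩
      have hlen : L'.length < n := by
        rw [← hn, ← hp.length_eq, List.length_append, List.length_ofFn]
        omega
      have hbase : IsUniversal fun N => wordWeight N α (List.ofFn e ++ L') :=
        ((IsUniversal.casimir hk).mul (ih _ hlen L' α hL' hα₂ rfl)).congr fun N hN => by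
          rw [wordWeight_append hN α hd hα₁ hα₂, wordWeight_ofFn hN α (finRotate k) he hrot]
          rfl
      -- Universality passes from the order with the cycle in front back to the given order.
      refine isUniversal_wordWeight_of_perm (n := n)
        (fun L α hL hnd hα => ih _ hL L α hnd hα rfl) α hp [] ?_ hCnd ?_ hbase
      · exact hp.length_eq.trans hn
      · intro y hy
        exact hp.mem_iff.2 (hα y (hp.mem_iff.1 hy))

end Words

/-! ### Existence of the universal weight system and the theorem -/

theorem exists_isUniversalWeightSystem :
    ∃ w : ∀ m : ℕ, Equiv.Perm (Fin m) → CasimirRing, IsUniversalWeightSystem w := by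
  have h : ∀ (m : ℕ) (α : Equiv.Perm (Fin m)), IsUniversal fun N => weightSystem N α :=
    fun m α => (isUniversal_wordWeight (List.ofFn (id : Fin m → Fin m)) α
      (List.nodup_ofFn.2 Function.injective_id) fun x _ => by simp).congr fun N hN =>
        (wordWeight_ofFn hN α α Function.injective_id fun _ => rfl).symm
  choose w hw using h
  exact ⟨w, fun N hN m α => hw m α N hN⟩

theorem mainTheorem4 :
    -- for every `N`, the map `T` sends `C_k` to `N^{k-1}`, and `T` of any polynomial in the Casimir
    -- elements is found by this substitution
    (∀ N : ℕ, 0 < N → ∀ k : ℕ, 0 < k →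
      normalizedTrace N (casimir N k) = (N : ℂ) ^ (k - 1)) ∧
    (∀ N : ℕ, 0 < N → ∀ P : CasimirRing,
      normalizedTrace N (specialize N P : Ugl N) = (universalTrace P).eval (N : ℂ)) ∧
    -- for every `N`, the map `T ∘ w_{gl(N)}` sends `α` to `N^{f(α)-1}`
    (∀ (m : ℕ) (α : Equiv.Perm (Fin m)), 1 ≤ numFaces α ∧
      ∀ N : ℕ, 0 < N → normalizedTrace N (weightSystem N α) = (N : ℂ) ^ (numFaces α - 1)) ∧
    -- the universal weight system exists, and `T ∘ w_gl` sends `α` to the monomial `N^{f(α)-1}`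
    (∃ w : ∀ m : ℕ, Equiv.Perm (Fin m) → CasimirRing, IsUniversalWeightSystem w) ∧
    (∀ w : ∀ m : ℕ, Equiv.Perm (Fin m) → CasimirRing, IsUniversalWeightSystem w →
      ∀ (m : ℕ) (α : Equiv.Perm (Fin m)),
        universalTrace (w m α) = (Polynomial.X : Polynomial ℂ) ^ (numFaces α - 1)) := by
  exact ⟨fun N hN k hk => normalizedTrace_of_scalar hN (standardRep_casimir N k hk),
    fun N hN P => normalizedTrace_of_scalar hN (standardRep_specialize N P),
    fun m α => ⟨numFaces_pos α, fun N hN => normalizedTrace_weightSystem hN α⟩,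
    exists_isUniversalWeightSystem,
    fun w hw m α => universalTrace_of_isUniversalWeightSystem hw m α⟩
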